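/- An *abelian monoidal category* is a monoidal category $(\mathcal C,\otimes,\mathbb 1)$ whose underlying category is abelian and such that $X\otimes -$ and $-\otimes X$ are additive for every $X\in\mathcal C$. Let $A=(A,m_A,u_A)$ be a non-zero (associative, unital) algebra in an abelian monoidal category $\mathcal C$, and let $A\text{-}\mathsf{Mod}(\mathcal C)$ and $\mathsf{Mod}\text{-}A(\mathcal C)$ be the categories of left and right $A$-modules in $\mathcal C$. Call $A$ * *left (resp. right) monadic* if the monad $A\otimes -$ (resp. $-\otimes A$) on $\mathcal C$, with multiplication induced by $m_A$ and unit induced by $u_A$, is such that the comparison functor $Y\mapsto (T(Y),\mu_Y)$ from its Kleisli category to its Eilenberg–Moore category is an equivalence (here $T$ is the monad and $\mu$ its multiplication); * *left (resp. right) essential* if the free-module functor $A\otimes -:\mathcal C\to A\text{-}\mathsf{Mod}(\mathcal C)$ (resp. $-\otimes A:\mathcal C\to \mathsf{Mod}\text{-}A(\mathcal C)$) is essentially surjective; * *left (resp. right) simplistic* if the regular module $A$ is a simple object of $A\text{-}\mathsf{Mod}(\mathcal C)$ (resp. $\mathsf{Mod}\text{-}A(\mathcal C)$). Then: (i) $A$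 is left monadic if and only if it is left essential, and $A$ is right monadic if and only if it is right essential. (ii) Suppose that $\mathcal C$ is rigid and that $\mathbb 1$ is a simple object. If $A$ has a simple left module in $\mathcal C$ and is left essential, then $A$ is left simplistic. If $A$ has a simple right module in $\mathcal C$ and is right essential, then $A$ is right simplistic. (iii) Suppose that $\mathcal C$ is a pivotal multifusion category over an algebraically closed field $\Bbbk$ of characteristic zero; that is, $\mathcal C$ is a $\Bbbk$-linear abelian monoidal category ($\otimes$ being $\Bbbk$-linear in each variable) that is rigid and semisimple, in which all objects have finite length, all Hom-spaces are finite-dimensional, there are enough projectives and only finitely many isomorphism classes of simple objects, and there is a monoidal natural isomorphism $\mathrm{Id}_{\mathcal C}\cong (-)^{**}$. Then $A$ is left monadic if and only if it is right monadic, left essential if and only if it is right essential, and left simplistic if and only if it is right simplistic. -/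

import Mathlib

open CategoryTheory MonoidalCategory Limits

universe w v u

namespace DivAlg

noncomputable section

variable {C : Type u} [Category.{v} C] [MonoidalCategory C]

/-! ### Modules over an algebra

An algebra in `C` is an object `A` with Mathlib's `MonObj A`. The category of left `A`-modules in
`C` is Mathlib's `Mod C A`, for the action of `C` on itself by tensoring on the left. -/

/-- A right module in `C` over the algebra `A`. -/
structure RightMod (A : C) [MonObj A] where
  /-- The underlying object. -/
  X : C
  /-- The right action. -/
  act : X ⊗ A ⟶ X
  act_one : X ◁ MonObj.one (X := A) ≫ act = (ρ_ X).hom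
  act_mul : X ◁ MonObj.mul (X := A) ≫ act = (α_ X A A).inv ≫ act ▷ A ≫ act

namespace RightMod

variable {A : C} [MonObj A]

/-- A morphism of right modules. -/
@[ext]
structure Hom (M N : RightMod A) where
  /-- The underlying morphism. -/
  hom : M.X ⟶ N.X
  act_hom : M.act ≫ hom = hom ▷ A ≫ N.act

instance : Category (RightMod A) where
  Hom M N := Hom M N
  id M := ⟨𝟙 M.X, by simp⟩
  comp f g := ⟨f.hom ≫ g.hom, by
    rw [← Category.assoc, f.act_hom, Category.assoc, g.act_hom, comp_whiskerRight,
      Category.assoc]⟩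

@[ext]
lemma hom_ext {M N : RightMod A} (f g : M ⟶ N) (h : f.hom = g.hom) : f = g :=
  Hom.ext h

@[simp]
lemma id_hom (M : RightMod A) : (𝟙 M : M ⟶ M).hom = 𝟙 M.X := rfl

@[simp]
lemma comp_hom {M N K : RightMod A} (f : M ⟶ N) (g : N ⟶ K) :
    (f ≫ g).hom = f.hom ≫ g.hom := rfl

variable (A) in
/-- The regular right module. -/
def regular : RightMod A where
  X := A
  act := MonObj.mul
  act_one := MonObj.mul_one A
  act_mul := by simp [MonObj.mul_assoc]

end RightMod

section Free

variable (A : C) [MonObj A]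

/-- The free left module `A ⊗ X`. -/
def freeLeftObj (X : C) : Mod C A :=
  letI : ModObj A (A ⊗ X) :=
    { smul := (α_ A A X).inv ≫ MonObj.mul ▷ X
      one_smul := by
        change MonObj.one ▷ (A ⊗ X) ≫ (α_ A A X).inv ≫ MonObj.mul ▷ X = (λ_ (A ⊗ X)).hom
        rw [← Category.assoc, associator_inv_naturality_left, Category.assoc,
          ← comp_whiskerRight, MonObj.one_mul]
        simp
      mul_smul := by
        change MonObj.mul ▷ (A ⊗ X) ≫ (α_ A A X).inv ≫ MonObj.mul ▷ X =
          (α_ A A (A ⊗ X)).hom ≫ A ◁ ((α_ A A X).inv ≫ MonObj.mul ▷ X) ≫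
            (α_ A A X).inv ≫ MonObj.mul ▷ X
        rw [← Category.assoc, associator_inv_naturality_left, Category.assoc,
          ← comp_whiskerRight, MonObj.mul_assoc]
        simp }
  ⟨A ⊗ X⟩

/-- The free left module functor `A ⊗ - : C ⥤ A-Mod(C)`. -/
def freeLeft : C ⥤ Mod C A where
  obj X := freeLeftObj A X
  map {X Y} f := Mod.Hom.mk' (M := freeLeftObj A X) (N := freeLeftObj A Y) (A ◁ f) (by
    change ((α_ A A X).inv ≫ MonObj.mul ▷ X) ≫ A ◁ f =
      A ◁ (A ◁ f) ≫ (α_ A A Y).inv ≫ MonObj.mul ▷ Y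
    simp [← whisker_exchange])
  map_id X := by
    apply Mod.hom_ext
    exact whiskerLeft_id A X
  map_comp f g := by
    apply Mod.hom_ext
    exact whiskerLeft_comp A f g

/-- The free right module functor `- ⊗ A : C ⥤ Mod-A(C)`. -/
def freeRight : C ⥤ RightMod A where
  obj X :=
    { X := X ⊗ A
      act := (α_ X A A).hom ≫ X ◁ MonObj.mul
      act_one := by
        simp [← whiskerLeft_comp]
      act_mul := by
        simp [← whiskerLeft_comp, MonObj.mul_assoc] }
  map f := ⟨f ▷ A, by simp [whisker_exchange]⟩

/-! ### The two monads of an algebra -/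

/-- The monad `A ⊗ -` on `C`. -/
def leftMonad : Monad C where
  toFunctor := tensorLeft A
  η := { app := fun X => (λ_ X).inv ≫ MonObj.one ▷ X
         naturality := by
          intro X Y f
          simp [← whisker_exchange] }
  μ := { app := fun X => (α_ A A X).inv ≫ MonObj.mul ▷ X
         naturality := by
          intro X Y f
          simp [← whisker_exchange] }
  assoc := by
    intro X
    have h := congrArg (fun f => f ▷ X) (MonObj.mul_assoc A)
    simp only [comp_whiskerRight] at h
    simp [h]
  left_unit := by
    intro X
    have h := congrArg (fun f => f ▷ X) (MonObj.one_mul A)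
    simp only [comp_whiskerRight] at h
    simp [h]
  right_unit := by
    intro X
    have h := congrArg (fun f => f ▷ X) (MonObj.mul_one A)
    simp only [comp_whiskerRight] at h
    simp [associator_inv_naturality_middle_assoc, -whisker_assoc, h]

/-- The monad `- ⊗ A` on `C`. -/
def rightMonad : Monad C where
  toFunctor := tensorRight A
  η := { app := fun X => (ρ_ X).inv ≫ X ◁ MonObj.one
         naturality := by
          intro X Y f
          simp [whisker_exchange] }
  μ := { app := fun X => (α_ X A A).hom ≫ X ◁ MonObj.mul
         naturality := by
          intro X Y f
          simp [whisker_exchange] }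
  assoc := by
    intro X
    have h := congrArg (fun f => X ◁ f) (MonObj.mul_assoc A)
    simp only [whiskerLeft_comp] at h
    simp [h]
  left_unit := by
    intro X
    have h := congrArg (fun f => X ◁ f) (MonObj.mul_one A)
    simp only [whiskerLeft_comp] at h
    simp [h]
  right_unit := by
    intro X
    have h := congrArg (fun f => X ◁ f) (MonObj.one_mul A)
    simp only [whiskerLeft_comp] at h
    simp [h]

end Free

/-- The comparison functor from the Kleisli category to the Eilenberg–Moore category of a monad:
`Y ↦ (T Y, μ_Y)` and `f ↦ T f ≫ μ`. -/
def kleisliComparison {D : Type u} [Category.{v} D] (T : Monad D) : Kleisli T ⥤ T.Algebra where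
  obj Y := T.free.obj Y.of
  map {Y Z} f :=
    { f := T.map f.of ≫ T.μ.app Z.of
      h := by
        change T.map (T.map f.of ≫ T.μ.app Z.of) ≫ T.μ.app Z.of =
          T.μ.app Y.of ≫ T.map f.of ≫ T.μ.app Z.of
        rw [T.map_comp, Category.assoc, T.assoc, T.mu_naturality_assoc] }
  map_id Y := by
    ext
    exact T.right_unit Y.of
  map_comp {X Y Z} f g := by
    ext
    exact (Kleisli.Adjunction.fromKleisli T).map_comp f g

/-- A monad is adjunction-trivial if the comparison functor from its Kleisli category to its
Eilenberg–Moore category is an equivalence. -/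
def AdjunctionTrivial {D : Type u} [Category.{v} D] (T : Monad D) : Prop :=
  (kleisliComparison T).IsEquivalence

/-! ### Zero morphisms between modules -/

section Zero

variable [Preadditive C] [MonoidalPreadditive C] (A : C) [MonObj A]

instance : HasZeroMorphisms (Mod C A) where
  zero M N := ⟨Mod.Hom.mk' (M := M) (N := N) 0 (by
    change _ ≫ (0 : M.X ⟶ N.X) = A ◁ (0 : M.X ⟶ N.X) ≫ _
    simp)⟩
  comp_zero f N := by
    apply Mod.hom_ext
    exact comp_zero
  zero_comp M _ _ f := by
    apply Mod.hom_ext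
    exact zero_comp

instance : HasZeroMorphisms (RightMod A) where
  zero M N := ⟨⟨0, by simp⟩⟩
  comp_zero f N := by
    apply RightMod.hom_ext
    exact comp_zero
  zero_comp M _ _ f := by
    apply RightMod.hom_ext
    exact zero_comp

end Zero

/-! ### Division algebras -/

section DivisionAlgebras

variable (A : C) [MonObj A]

/-- Left monadic division algebra. -/
def IsLeftMonadic : Prop := ¬ IsZero A ∧ AdjunctionTrivial (leftMonad A)

/-- Right monadic division algebra. -/
def IsRightMonadic : Prop := ¬ IsZero A ∧ AdjunctionTrivial (rightMonad A)

/-- Left essential division algebra. -/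
def IsLeftEssential : Prop := ¬ IsZero A ∧ (freeLeft A).EssSurj

/-- Right essential division algebra. -/
def IsRightEssential : Prop := ¬ IsZero A ∧ (freeRight A).EssSurj

variable [Preadditive C] [MonoidalPreadditive C]

/-- Left simplistic division algebra. -/
def IsLeftSimplistic : Prop := ¬ IsZero A ∧ Simple (Mod.regular A)

/-- Right simplistic division algebra. -/
def IsRightSimplistic : Prop := ¬ IsZero A ∧ Simple (RightMod.regular A)

end DivisionAlgebras

/-! ### Pivotal categories

The dual `X*` with `ev : X* ⊗ X ⟶ 𝟙` and `coev : 𝟙 ⟶ X ⊗ X*` is called the right dual in Mathlib. -/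

section Pivotal

variable [RigidCategory C]

/-- The dual `X*` chosen by the rigid structure. -/
def dual (X : C) : C :=
  (RightRigidCategory.rightDual X).rightDual

/-- The pairing of `X` with `X*`. -/
@[reducible]
def dualPairing (X : C) : ExactPairing X (dual X) :=
  (RightRigidCategory.rightDual X).exact

/-- The dual `f* : Y* ⟶ X*` of a morphism `f : X ⟶ Y`. -/
def dualMap {X Y : C} (f : X ⟶ Y) : dual Y ⟶ dual X :=
  @rightAdjointMate C _ _ X Y (RightRigidCategory.rightDual X) (RightRigidCategory.rightDual Y) f

/-- The canonical isomorphism `(X ⊗ Y)* ≅ Y* ⊗ X*`. -/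
def dualTensorIso (X Y : C) : dual (X ⊗ Y) ≅ dual Y ⊗ dual X :=
  letI := dualPairing X
  letI := dualPairing Y
  rightDualIso (dualPairing (X ⊗ Y)) ExactPairing.tensor

variable (C) in
/-- The canonical isomorphism `𝟙* ≅ 𝟙`. -/
def dualUnitIso : dual (𝟙_ C) ≅ 𝟙_ C :=
  rightDualIso (dualPairing (𝟙_ C)) exactPairingUnit

/-- The tensor structure `X** ⊗ Y** ⟶ (X ⊗ Y)**` of the double dual functor. -/
def doubleDualTensor (X Y : C) : dual (dual X) ⊗ dual (dual Y) ⟶ dual (dual (X ⊗ Y)) :=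
  (dualTensorIso (dual Y) (dual X)).inv ≫ dualMap (dualTensorIso X Y).hom

variable (C) in
/-- The unit structure `𝟙 ⟶ 𝟙**` of the double dual functor. -/
def doubleDualUnit : 𝟙_ C ⟶ dual (dual (𝟙_ C)) :=
  (dualUnitIso C).inv ≫ dualMap (dualUnitIso C).hom

variable (C) in
/-- A pivotal structure: a monoidal natural isomorphism `X ≅ X**`. -/
structure PivotalStructure where
  /-- The components of the isomorphism. -/
  iso (X : C) : X ≅ dual (dual X)
  naturality {X Y : C} (f : X ⟶ Y) : f ≫ (iso Y).hom = (iso X).hom ≫ dualMap (dualMap f)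
  tensor (X Y : C) :
    (iso (X ⊗ Y)).hom = ((iso X).hom ⊗ₘ (iso Y).hom) ≫ doubleDualTensor X Y
  unit : (iso (𝟙_ C)).hom = doubleDualUnit C

end Pivotal

/-! ### Multifusion categories -/

/-- A `k`-linear abelian category is finite if all objects have finite length, all Hom-spaces are
finite-dimensional, there are enough projectives, and there are finitely many isomorphism classes
of simple objects. -/
structure IsFiniteLinear (k : Type w) [Field k] (D : Type u) [Category.{v} D] [Abelian D]
    [Linear k D] : Prop where
  finite_length (X : D) : IsArtinianObject X ∧ IsNoetherianObject X
  finite_hom (X Y : D) : FiniteDimensional k (X ⟶ Y)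
  enough_projectives : EnoughProjectives D
  finite_simples : ∃ (n : ℕ) (S : Fin n → D),
    ∀ X : D, Simple X → ∃ i, Nonempty (X ≅ S i)

/-- An abelian category is semisimple if every object is a finite direct sum of simple objects. -/
def IsSemisimple (D : Type u) [Category.{v} D] [Abelian D] : Prop :=
  ∀ X : D, ∃ (n : ℕ) (S : Fin n → D) (b : Bicone S),
    (∀ i, Simple (S i)) ∧ Nonempty b.IsBilimit ∧ Nonempty (X ≅ b.pt)

/-- A rigid `k`-linear abelian monoidal category is multifusion if it is finite and semisimple. -/
structure IsMultifusion (k : Type w) [Field k] (D : Type u) [Category.{v} D] [Abelian D]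
    [MonoidalCategory D] [MonoidalPreadditive D] [Linear k D] [MonoidalLinear k D]
    [RigidCategory D] : Prop where
  finite : IsFiniteLinear k D
  semisimple : IsSemisimple D

end

end DivAlg

namespace DivAlg

section Semisimple

variable {D : Type u} [Category.{v} D] [Abelian D]

/-- An epimorphism onto a simple object of a semisimple category splits. -/
lemma IsSemisimple.exists_section (h : IsSemisimple D) {E S : D} [Simple S] (f : E ⟶ S) [Epi f] :
    ∃ s : S ⟶ E, s ≫ f = 𝟙 S := by
  obtain ⟨n, T, b, hT, ⟨hb⟩, ⟨e⟩⟩ := h E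
  have hf : f ≠ 0 := by
    rintro rfl
    exact id_nonzero S ((cancel_epi (0 : E ⟶ S)).1 (by simp))
  obtain ⟨j, hj⟩ : ∃ j, b.ι j ≫ e.inv ≫ f ≠ 0 := by
    by_contra! hc
    apply hf
    rw [← cancel_epi e.inv, comp_zero]
    refine hb.isColimit.hom_ext fun ⟨j⟩ => ?_
    simpa using hc j
  have := hT j
  have := isIso_of_hom_simple hj
  exact ⟨inv (b.ι j ≫ e.inv ≫ f) ≫ b.ι j ≫ e.inv, by simp⟩

lemma IsSemisimple.projective_of_simple (h : IsSemisimple D) (S : D) [Simple S] :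
    Projective S where
  factors {E X} g f _ := by
    obtain ⟨s, hs⟩ := h.exists_section (pullback.fst g f)
    exact ⟨s ≫ pullback.snd g f, by
      rw [Category.assoc, ← pullback.condition, reassoc_of% hs]⟩

/-- Every object of a semisimple abelian category is projective. -/
lemma IsSemisimple.projective (h : IsSemisimple D) (X : D) : Projective X := by
  obtain ⟨n, T, b, hT, ⟨hb⟩, ⟨e⟩⟩ := h X
  refine Projective.of_iso e.symm ⟨fun {E Y} g f _ => ?_⟩
  have hl (j : Fin n) : ∃ l : T j ⟶ E, l ≫ f = b.ι j ≫ g := by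
    have := hT j
    have := h.projective_of_simple (T j)
    exact ⟨Projective.factorThru (b.ι j ≫ g) f, by simp⟩
  choose l hl using hl
  let d : b.pt ⟶ E := hb.isColimit.desc (Cofan.mk E l)
  have hd (j : Fin n) : b.ι j ≫ d = l j := hb.isColimit.fac (Cofan.mk E l) ⟨j⟩
  refine ⟨d, hb.isColimit.hom_ext fun ⟨j⟩ => ?_⟩
  change b.ι j ≫ d ≫ f = b.ι j ≫ g
  rw [← Category.assoc, hd, hl]

/-- If all objects are projective, every morphism is von Neumann regular. -/
lemma exists_comp_comp_self (hP : ∀ X : D, Projective X) {X Y : D} (f : X ⟶ Y) :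
    ∃ g : Y ⟶ X, f ≫ g ≫ f = f := by
  have := hP (Abelian.image f)
  have := hP (cokernel f)
  let s := Projective.factorThru (𝟙 _) (Abelian.factorThruImage f)
  have hs : s ≫ Abelian.factorThruImage f = 𝟙 _ := Projective.factorThru_comp _ _
  let t := Projective.factorThru (𝟙 _) (cokernel.π f)
  have ht : t ≫ cokernel.π f = 𝟙 _ := Projective.factorThru_comp _ _
  let r : Y ⟶ Abelian.image f := kernel.lift _ (𝟙 Y - cokernel.π f ≫ t) (by simp [ht])
  have hr : r ≫ Abelian.image.ι f = 𝟙 Y - cokernel.π f ≫ t := kernel.lift_ι _ _ _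
  refine ⟨r ≫ s, ?_⟩
  have hf : s ≫ f = Abelian.image.ι f := by
    calc s ≫ f = s ≫ Abelian.factorThruImage f ≫ Abelian.image.ι f := by rw [Abelian.image.fac]
      _ = _ := by rw [reassoc_of% hs]
  rw [Category.assoc, hf, hr]
  simp

variable {k : Type w} [Field k] [Linear k D]

variable (k) in
/-- The trace of the endomorphism `v ↦ v ≫ e` of `End X`. -/
noncomputable def compTrace (X : D) : (X ⟶ X) →ₗ[k] k :=
  LinearMap.trace k (X ⟶ X) ∘ₗ (Linear.comp X X X).flip

lemma compTrace_ne_zero_of_idempotent [CharZero k] {X : D} [FiniteDimensional k (X ⟶ X)]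
    {e : X ⟶ X} (he : e ≫ e = e) (h0 : e ≠ 0) : compTrace k X e ≠ 0 := by
  intro h
  have hi : IsIdempotentElem
      (show Module.End k (X ⟶ X) from (Linear.comp X X X : _ →ₗ[k] _ →ₗ[k] _).flip e) := by
    ext v
    simp [he]
  have := LinearMap.IsIdempotentElem.eq_zero_of_trace_eq_zero hi h
  apply h0
  simpa using LinearMap.congr_fun this (𝟙 X)

variable (k) in
/-- The trace pairing between `Y ⟶ X` and `X ⟶ Y`. -/
noncomputable def tracePairing (X Y : D) : (Y ⟶ X) →ₗ[k] Module.Dual k (X ⟶ Y) :=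
  (LinearMap.llcomp k _ _ _ (compTrace k X)) ∘ₗ (Linear.comp X Y X).flip

@[simp]
lemma tracePairing_apply (X Y : D) (f : Y ⟶ X) (u : X ⟶ Y) :
    tracePairing k X Y f u = compTrace k X (u ≫ f) := rfl

lemma tracePairing_injective [CharZero k] (hP : ∀ X : D, Projective X)
    [hF : ∀ X Y : D, FiniteDimensional k (X ⟶ Y)] (X Y : D) :
    Function.Injective (tracePairing k X Y) := by
  rw [injective_iff_map_eq_zero]
  intro f hf
  by_contra h0
  obtain ⟨g, hg⟩ := exists_comp_comp_self hP f
  refine compTrace_ne_zero_of_idempotent (k := k) (e := g ≫ f) (by simp [hg]) ?_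
    (LinearMap.congr_fun hf g)
  intro h
  apply h0
  rw [← hg, h, comp_zero]

/-- In a semisimple category over a field of characteristic zero the trace pairing is perfect. -/
lemma tracePairing_surjective [CharZero k] (hP : ∀ X : D, Projective X)
    [hF : ∀ X Y : D, FiniteDimensional k (X ⟶ Y)] (X Y : D) :
    Function.Surjective (tracePairing k X Y) := by
  have h₁ := LinearMap.finrank_le_finrank_of_injective (tracePairing_injective (k := k) hP X Y)
  have h₂ := LinearMap.finrank_le_finrank_of_injective (tracePairing_injective (k := k) hP Y X)
  rw [Subspace.dual_finrank_eq] at h₁ h₂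
  refine (LinearMap.injective_iff_surjective_of_finrank_eq_finrank ?_).1
    (tracePairing_injective hP X Y)
  rw [Subspace.dual_finrank_eq]
  omega

end Semisimple

end DivAlg

namespace DivAlg

section Kleisli

variable {D : Type u} [Category.{v} D] (T : Monad D)

lemma monad_unit_map_mul {X Z : D} (f : X ⟶ T.obj Z) :
    T.η.app X ≫ T.map f ≫ T.μ.app Z = f := by
  have h : f ≫ T.η.app (T.obj Z) = T.η.app X ≫ T.map f := T.η.naturality f
  rw [← Category.assoc, ← h, Category.assoc, T.left_unit]
  exact Category.comp_id f

lemma monad_map_unit_comp {X Z : D} (f : T.obj X ⟶ T.obj Z)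
    (h : T.map f ≫ T.μ.app Z = T.μ.app X ≫ f) :
    T.map (T.η.app X ≫ f) ≫ T.μ.app Z = f := by
  rw [T.map_comp, Category.assoc, h, ← Category.assoc, T.right_unit, Category.id_comp]

instance kleisliComparison_full : (kleisliComparison T).Full where
  map_surjective {Y Z} f := ⟨⟨T.η.app Y.of ≫ f.f⟩, by
    ext
    exact monad_map_unit_comp T (X := Y.of) (Z := Z.of) f.f f.h⟩

instance kleisliComparison_faithful : (kleisliComparison T).Faithful where
  map_injective {Y Z} f g h := by
    have h' : T.map f.of ≫ T.μ.app Z.of = T.map g.of ≫ T.μ.app Z.of :=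
      congrArg Monad.Algebra.Hom.f h
    apply Kleisli.Hom.ext
    exact (monad_unit_map_mul T f.of).symm.trans
      ((congrArg (T.η.app Y.of ≫ ·) h').trans (monad_unit_map_mul T g.of))

lemma adjunctionTrivial_iff : AdjunctionTrivial T ↔ (kleisliComparison T).EssSurj :=
  ⟨fun h => h.essSurj, fun _ => { }⟩

end Kleisli

variable {C : Type u} [Category.{v} C] [MonoidalCategory C] {A : C} [MonObj A]

/-! ### Left modules -/

/-- The action map of a left module. -/
def act (M : Mod C A) : A ⊗ M.X ⟶ M.X := ModObj.smul (M := A) (X := M.X)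

lemma one_act (M : Mod C A) : MonObj.one (X := A) ▷ M.X ≫ act M = (λ_ M.X).hom :=
  ModObj.one_smul (M := A) M.X

lemma mul_act (M : Mod C A) :
    MonObj.mul (X := A) ▷ M.X ≫ act M = (α_ A A M.X).hom ≫ A ◁ act M ≫ act M :=
  ModObj.mul_smul (M := A) M.X

lemma act_hom {M N : Mod C A} (f : M ⟶ N) : act M ≫ f.hom = A ◁ f.hom ≫ act N :=
  IsModHom.smul_hom (A := A) (f := f.hom)

/-- A left module from its action map. -/
abbrev mkMod (X : C) (a : A ⊗ X ⟶ X) (h₁ : MonObj.one (X := A) ▷ X ≫ a = (λ_ X).hom)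
    (h₂ : MonObj.mul (X := A) ▷ X ≫ a = (α_ A A X).hom ≫ A ◁ a ≫ a) : Mod C A :=
  letI : ModObj A X := { smul := a, one_smul := h₁, mul_smul := h₂ }
  ⟨X⟩

/-- A morphism of left modules from an equivariant morphism. -/
abbrev mkModHom {M N : Mod C A} (f : M.X ⟶ N.X) (h : act M ≫ f = A ◁ f ≫ act N) : M ⟶ N :=
  Mod.Hom.mk' f h

/-- A morphism of left modules is invertible if the underlying morphism is. -/
lemma isIso_of_isIso_hom {M N : Mod C A} (f : M ⟶ N) [IsIso f.hom] : IsIso f := by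
  refine ⟨mkModHom (inv f.hom) ?_, ?_, ?_⟩
  · rw [IsIso.comp_inv_eq, Category.assoc, act_hom, ← whiskerLeft_comp_assoc]
    simp
  · ext
    exact IsIso.hom_inv_id f.hom
  · ext
    exact IsIso.inv_hom_id f.hom

lemma isIso_hom {M N : Mod C A} (f : M ⟶ N) [IsIso f] : IsIso f.hom :=
  inferInstanceAs (IsIso ((Mod.forget A).map f))

lemma RightMod.isIso_of_isIso_hom {M N : RightMod A} (f : M ⟶ N) [IsIso f.hom] : IsIso f := by
  refine ⟨⟨inv f.hom, ?_⟩, ?_, ?_⟩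
  · rw [IsIso.comp_inv_eq, Category.assoc, f.act_hom, ← comp_whiskerRight_assoc]
    simp
  · ext
    exact IsIso.hom_inv_id f.hom
  · ext
    exact IsIso.inv_hom_id f.hom

/-! ### Monadic and essential algebras -/

lemma adjunctionTrivial_leftMonad_iff :
    AdjunctionTrivial (leftMonad A) ↔ (freeLeft A).EssSurj := by
  rw [adjunctionTrivial_iff]
  constructor
  · intro h
    refine ⟨fun M => ?_⟩
    let M' : (leftMonad A).Algebra :=
      { A := M.X
        a := act M
        unit := by
          change ((λ_ M.X).inv ≫ MonObj.one (X := A) ▷ M.X) ≫ act M = 𝟙 _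
          rw [Category.assoc, one_act, Iso.inv_hom_id]
        assoc := by
          change ((α_ A A M.X).inv ≫ MonObj.mul (X := A) ▷ M.X) ≫ act M = A ◁ act M ≫ act M
          rw [Category.assoc, mul_act, Iso.inv_hom_id_assoc] }
    obtain ⟨Y, ⟨e⟩⟩ := h.mem_essImage M'
    have he : A ◁ e.hom.f ≫ act M = act ((freeLeft A).obj Y.of) ≫ e.hom.f := e.hom.h
    let g : (freeLeft A).obj Y.of ⟶ M := mkModHom e.hom.f he.symm
    have : IsIso g.hom := inferInstanceAs (IsIso ((leftMonad A).forget.map e.hom))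
    have := isIso_of_isIso_hom g
    exact ⟨Y.of, ⟨asIso g⟩⟩
  · intro h
    refine ⟨fun M => ?_⟩
    let M' : Mod C A := mkMod M.A M.a
      (((Iso.inv_comp_eq _).1 ((Category.assoc _ _ _).symm.trans M.unit)).trans
        (Category.comp_id _))
      ((Iso.inv_comp_eq _).1 ((Category.assoc _ _ _).symm.trans M.assoc))
    obtain ⟨Y, ⟨e⟩⟩ := h.mem_essImage M'
    let g : (kleisliComparison (leftMonad A)).obj (Kleisli.mk _ Y) ⟶ M :=
      { f := e.hom.hom
        h := (act_hom e.hom).symm }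
    have : IsIso g.f := inferInstanceAs (IsIso ((Mod.forget A).map e.hom))
    have := Monad.algebra_iso_of_iso _ g
    exact ⟨Kleisli.mk _ Y, ⟨asIso g⟩⟩

lemma adjunctionTrivial_rightMonad_iff :
    AdjunctionTrivial (rightMonad A) ↔ (freeRight A).EssSurj := by
  rw [adjunctionTrivial_iff]
  constructor
  · intro h
    refine ⟨fun M => ?_⟩
    let M' : (rightMonad A).Algebra :=
      { A := M.X
        a := M.act
        unit := by
          change ((ρ_ M.X).inv ≫ M.X ◁ MonObj.one (X := A)) ≫ M.act = 𝟙 _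
          rw [Category.assoc, M.act_one, Iso.inv_hom_id]
        assoc := by
          change ((α_ M.X A A).hom ≫ M.X ◁ MonObj.mul (X := A)) ≫ M.act = M.act ▷ A ≫ M.act
          rw [Category.assoc, M.act_mul, Iso.hom_inv_id_assoc] }
    obtain ⟨Y, ⟨e⟩⟩ := h.mem_essImage M'
    have he : e.hom.f ▷ A ≫ M.act = ((freeRight A).obj Y.of).act ≫ e.hom.f := e.hom.h
    let g : (freeRight A).obj Y.of ⟶ M := ⟨e.hom.f, he.symm⟩
    have : IsIso g.hom := inferInstanceAs (IsIso ((rightMonad A).forget.map e.hom))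
    have := RightMod.isIso_of_isIso_hom g
    exact ⟨Y.of, ⟨asIso g⟩⟩
  · intro h
    refine ⟨fun M => ?_⟩
    let M' : RightMod A :=
      { X := M.A
        act := M.a
        act_one := ((Iso.inv_comp_eq _).1 ((Category.assoc _ _ _).symm.trans M.unit)).trans
          (Category.comp_id _)
        act_mul := (Iso.eq_inv_comp _).2 ((Category.assoc _ _ _).symm.trans M.assoc) }
    obtain ⟨Y, ⟨e⟩⟩ := h.mem_essImage M'
    let g : (kleisliComparison (rightMonad A)).obj (Kleisli.mk _ Y) ⟶ M :=
      { f := e.hom.hom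
        h := e.hom.act_hom.symm }
    have : IsIso g.f :=
      ⟨e.inv.hom, congrArg RightMod.Hom.hom e.hom_inv_id, congrArg RightMod.Hom.hom e.inv_hom_id⟩
    have := Monad.algebra_iso_of_iso _ g
    exact ⟨Kleisli.mk _ Y, ⟨asIso g⟩⟩

theorem isLeftMonadic_iff_isLeftEssential : IsLeftMonadic A ↔ IsLeftEssential A :=
  and_congr_right' adjunctionTrivial_leftMonad_iff

theorem isRightMonadic_iff_isRightEssential : IsRightMonadic A ↔ IsRightEssential A :=
  and_congr_right' adjunctionTrivial_rightMonad_iff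

/-! ### Exactness of tensoring with a dualizable object -/

instance mono_whiskerLeft [RightRigidCategory C] (X : C) {M N : C} (f : M ⟶ N) [Mono f] :
    Mono (X ◁ f) := by
  have := (tensorLeftAdjunction X (HasRightDual.rightDual X)).rightAdjoint_preservesLimits
  exact inferInstanceAs (Mono ((tensorLeft X).map f))

instance mono_whiskerRight [LeftRigidCategory C] (X : C) {M N : C} (f : M ⟶ N) [Mono f] :
    Mono (f ▷ X) := by
  have := (tensorRightAdjunction (HasLeftDual.leftDual X) X).rightAdjoint_preservesLimits
  exact inferInstanceAs (Mono ((tensorRight X).map f))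

instance epi_whiskerLeft [LeftRigidCategory C] (X : C) {M N : C} (f : M ⟶ N) [Epi f] :
    Epi (X ◁ f) := by
  have := (tensorLeftAdjunction (HasLeftDual.leftDual X) X).leftAdjoint_preservesColimits
  exact inferInstanceAs (Epi ((tensorLeft X).map f))

/-! ### Kernels, cokernels and tensor products of left modules -/

lemma eq_zero_of_hom_eq_zero [Preadditive C] [MonoidalPreadditive C] {M N : Mod C A}
    (f : M ⟶ N) (h : f.hom = 0) : f = 0 :=
  Mod.hom_ext _ _ h

lemma mono_of_mono_hom {M N : Mod C A} (f : M ⟶ N) [h : Mono f.hom] : Mono f := by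
  have : (Mod.forget (D := C) A).Faithful := ⟨fun h => Mod.hom_ext _ _ h⟩
  exact (Mod.forget A).mono_of_mono_map h

/-- The tensor product of a left module with an object. -/
def tensorMod (M : Mod C A) (X : C) : Mod C A :=
  mkMod (M.X ⊗ X) ((α_ A M.X X).inv ≫ act M ▷ X)
    (by
      rw [associator_inv_naturality_left_assoc, ← comp_whiskerRight, one_act]
      simp)
    (by
      rw [associator_inv_naturality_left_assoc, ← comp_whiskerRight, mul_act]
      simp)

/-- The tensor product of a morphism of left modules with an object. -/
def tensorModMap {M N : Mod C A} (f : M ⟶ N) (X : C) : tensorMod M X ⟶ tensorMod N X :=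
  mkModHom (f.hom ▷ X) (by
    change ((α_ A M.X X).inv ≫ act M ▷ X) ≫ f.hom ▷ X =
      A ◁ (f.hom ▷ X) ≫ (α_ A N.X X).inv ≫ act N ▷ X
    rw [Category.assoc, ← comp_whiskerRight, act_hom]
    simp)

section Abelian

variable [Abelian C] [MonoidalPreadditive C]

/-- The kernel of a morphism of left modules. -/
noncomputable def kernelMod {M N : Mod C A} (f : M ⟶ N) : Mod C A :=
  have hw : (A ◁ kernel.ι f.hom ≫ act M) ≫ f.hom = 0 := by
    rw [Category.assoc, act_hom, ← whiskerLeft_comp_assoc, kernel.condition]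
    simp
  have hl : kernel.lift f.hom _ hw ≫ kernel.ι f.hom = A ◁ kernel.ι f.hom ≫ act M :=
    kernel.lift_ι _ _ _
  mkMod (kernel f.hom) (kernel.lift f.hom (A ◁ kernel.ι f.hom ≫ act M) hw)
    (by
      rw [← cancel_mono (kernel.ι f.hom), Category.assoc, hl, ← whisker_exchange_assoc, one_act]
      simp)
    (by
      rw [← cancel_mono (kernel.ι f.hom), Category.assoc, hl, ← whisker_exchange_assoc, mul_act]
      simp only [Category.assoc, hl]
      rw [← whiskerLeft_comp_assoc, hl]
      simp)

/-- The inclusion of the kernel of a morphism of left modules. -/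
noncomputable def kernelModι {M N : Mod C A} (f : M ⟶ N) : kernelMod f ⟶ M :=
  mkModHom (kernel.ι f.hom) (kernel.lift_ι _ _ _)

lemma kernelModι_comp {M N : Mod C A} (f : M ⟶ N) : kernelModι f ≫ f = 0 :=
  Mod.hom_ext _ _ (kernel.condition f.hom)

lemma mono_hom_of_kernelModι_eq_zero {M N : Mod C A} {f : M ⟶ N} (h : kernelModι f = 0) :
    Mono f.hom :=
  Preadditive.mono_of_kernel_zero (congrArg Mod.Hom.hom h)

instance mono_kernelModι {M N : Mod C A} (f : M ⟶ N) : Mono (kernelModι f) :=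
  mono_of_mono_hom (h := inferInstanceAs (Mono (kernel.ι f.hom)))

instance mono_hom {M N : Mod C A} (f : M ⟶ N) [Mono f] : Mono f.hom := by
  apply mono_hom_of_kernelModι_eq_zero
  rw [← cancel_mono f, kernelModι_comp, zero_comp]

/-- A nonzero morphism out of a simple left module is a monomorphism. -/
lemma mono_hom_of_simple {M N : Mod C A} [Simple M] {f : M ⟶ N} (hf : f ≠ 0) : Mono f.hom := by
  apply mono_hom_of_kernelModι_eq_zero
  by_contra h
  have := isIso_of_mono_of_nonzero h
  apply hf
  rw [← cancel_epi (kernelModι f), kernelModι_comp, comp_zero]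

/-- The cokernel of a morphism of left modules. -/
lemma exists_cokernel [LeftRigidCategory C] {M N : Mod C A} (f : M ⟶ N) :
    ∃ (Q : Mod C A) (p : N ⟶ Q), Epi p.hom ∧ f.hom ≫ p.hom = 0 ∧
      ∀ {Z : C} (g : N.X ⟶ Z), f.hom ≫ g = 0 → ∃ g' : Q.X ⟶ Z, g = p.hom ≫ g' := by
  have := (tensorLeftAdjunction (HasLeftDual.leftDual A) A).leftAdjoint_preservesColimits
  let hc := CokernelCofork.mapIsColimit _ (cokernelIsCokernel f.hom) (tensorLeft A)
  obtain ⟨q, hq⟩ : ∃ q : A ⊗ cokernel f.hom ⟶ cokernel f.hom,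
      A ◁ cokernel.π f.hom ≫ q = act N ≫ cokernel.π f.hom := by
    obtain ⟨q, hq⟩ := CokernelCofork.IsColimit.desc' hc (act N ≫ cokernel.π f.hom) (by
      change A ◁ f.hom ≫ act N ≫ cokernel.π f.hom = 0
      rw [← Category.assoc, ← act_hom, Category.assoc, cokernel.condition, comp_zero])
    exact ⟨q, hq⟩
  let Q : Mod C A := mkMod (cokernel f.hom) q
    (by
      rw [← cancel_epi (𝟙_ C ◁ cokernel.π f.hom), whisker_exchange_assoc, hq, ← Category.assoc,
        one_act]
      simp)
    (by
      rw [← cancel_epi ((A ⊗ A) ◁ cokernel.π f.hom), whisker_exchange_assoc, hq, ← Category.assoc,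
        mul_act]
      simp only [tensor_whiskerLeft, Category.assoc, Iso.inv_hom_id_assoc, Iso.cancel_iso_hom_left]
      rw [← whiskerLeft_comp_assoc, hq, whiskerLeft_comp_assoc, hq])
  refine ⟨Q, mkModHom (cokernel.π f.hom) hq.symm, inferInstanceAs (Epi (cokernel.π f.hom)),
    cokernel.condition _, fun g hg => ⟨cokernel.desc _ g hg, (cokernel.π_desc _ _ _).symm⟩⟩

end Abelian

/-! ### Essential algebras over a simple unit -/

section SimpleUnit

variable [Abelian C] [MonoidalPreadditive C] [RigidCategory C] [Simple (𝟙_ C)]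

/-- If the unit is simple, the coevaluation of a nonzero object is a monomorphism. -/
lemma mono_coevaluation {X : C} (hX : ¬ IsZero X) : Mono (η_ X Xᘁ) := by
  have h0 : η_ X Xᘁ ≠ 0 := by
    intro h
    apply hX
    have := ExactPairing.evaluation_coevaluation X Xᘁ
    rw [h, MonoidalPreadditive.zero_whiskerRight, zero_comp] at this
    rw [IsZero.iff_id_eq_zero, ← cancel_mono (ρ_ X).inv, ← cancel_epi (λ_ X).hom]
    simp [← this]
  exact mono_of_nonzero_from_simple h0

/-- If the unit is simple, tensoring with a nonzero object is faithful. -/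
lemma whiskerRight_injective {X : C} (hX : ¬ IsZero X) {M N : C} {f g : M ⟶ N}
    (h : f ▷ X = g ▷ X) : f = g := by
  have := mono_coevaluation hX
  rw [← cancel_mono (ρ_ N).inv, ← cancel_mono (N ◁ η_ X Xᘁ)]
  have key (f : M ⟶ N) : (f ≫ (ρ_ N).inv) ≫ N ◁ η_ X Xᘁ =
      (ρ_ M).inv ≫ M ◁ η_ X Xᘁ ≫ (α_ _ _ _).inv ≫ (f ▷ X) ▷ Xᘁ ≫ (α_ _ _ _).hom := by
    rw [← associator_inv_naturality_left_assoc, Iso.inv_hom_id, Category.comp_id,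
      whisker_exchange]
    simp
  rw [key, key, h]

theorem simple_regular_of_simple (h : (freeLeft A).EssSurj) (hA : ¬ IsZero A)
    (S : Mod C A) [Simple S] : Simple (Mod.regular A) := by
  obtain ⟨X, ⟨e⟩⟩ := h.mem_essImage S
  have : Simple (tensorMod (Mod.regular A) X) := Simple.of_iso e
  have hX : ¬ IsZero X := by
    intro hX
    apply id_nonzero (tensorMod (Mod.regular A) X)
    apply Mod.hom_ext
    change 𝟙 (A ⊗ X) = 0
    rw [← whiskerLeft_id, hX.eq_of_src (𝟙 X) 0, MonoidalPreadditive.whiskerLeft_zero]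
  refine ⟨fun {I} i _ => ⟨?_, fun hi => ?_⟩⟩
  · rintro _ rfl
    have := isIso_hom (0 : I ⟶ Mod.regular A)
    have h0 : inv (0 : I ⟶ Mod.regular A).hom ≫ (0 : I ⟶ Mod.regular A).hom = 𝟙 A :=
      IsIso.inv_hom_id _
    exact hA ((IsZero.iff_id_eq_zero A).2 (h0.symm.trans comp_zero))
  · have : Mono (tensorModMap i X).hom := inferInstanceAs (Mono (i.hom ▷ X))
    have := mono_of_mono_hom (tensorModMap i X)
    have hne : tensorModMap i X ≠ 0 := by
      intro h0
      apply hi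
      apply eq_zero_of_hom_eq_zero
      apply whiskerRight_injective hX
      rw [MonoidalPreadditive.zero_whiskerRight]
      exact congrArg Mod.Hom.hom h0
    have := isIso_of_mono_of_nonzero hne
    have : IsIso (i.hom ▷ X) := isIso_hom (tensorModMap i X)
    have : Epi i.hom := ⟨fun g g' hg => by
      apply whiskerRight_injective hX
      rw [← cancel_epi (i.hom ▷ X), ← comp_whiskerRight, hg, comp_whiskerRight]⟩
    have := isIso_of_mono_of_epi i.hom
    exact isIso_of_isIso_hom i

end SimpleUnit

end DivAlg

namespace DivAlg

variable {C : Type u} [Category.{v} C] [MonoidalCategory C] {A : C} [MonObj A]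

/-! ### Transposition along an exact pairing -/

section Transpose

variable {X Y : C} [ExactPairing X Y] {Z : C}

variable (X) in
lemma exists_whiskerLeft_evaluation (b : Y ⊗ Z ⟶ 𝟙_ C) : ∃ z : Z ⟶ X, Y ◁ z ≫ ε_ X Y = b := by
  refine ⟨tensorLeftHomEquiv Z X Y (𝟙_ C) b ≫ (ρ_ X).hom, ?_⟩
  have h : Y ◁ tensorLeftHomEquiv Z X Y (𝟙_ C) b ≫ (α_ _ _ _).inv ≫ ε_ X Y ▷ 𝟙_ C ≫
      (λ_ (𝟙_ C)).hom = b := (tensorLeftHomEquiv Z X Y (𝟙_ C)).symm_apply_apply b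
  conv_rhs => rw [← h]
  rw [unitors_equal, rightUnitor_naturality]
  simp

lemma whiskerLeft_evaluation_injective {z z' : Z ⟶ X}
    (h : Y ◁ z ≫ ε_ X Y = Y ◁ z' ≫ ε_ X Y) : z = z' := by
  have key (z : Z ⟶ X) :
      z = (λ_ Z).inv ≫ η_ X Y ▷ Z ≫ (α_ _ _ _).hom ≫ X ◁ (Y ◁ z ≫ ε_ X Y) ≫ (ρ_ X).hom := by
    rw [whiskerLeft_comp_assoc, ← associator_naturality_right_assoc, ← whisker_exchange_assoc,
      ExactPairing.evaluation_coevaluation_assoc]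
    simp
  rw [key z, key z', h]

variable (Y) in
lemma exists_whiskerRight_evaluation (b : Z ⊗ X ⟶ 𝟙_ C) : ∃ z : Z ⟶ Y, z ▷ X ≫ ε_ X Y = b := by
  refine ⟨tensorRightHomEquiv Z X Y (𝟙_ C) b ≫ (λ_ Y).hom, ?_⟩
  have h : tensorRightHomEquiv Z X Y (𝟙_ C) b ▷ X ≫ (α_ _ _ _).hom ≫ 𝟙_ C ◁ ε_ X Y ≫
      (ρ_ (𝟙_ C)).hom = b := (tensorRightHomEquiv Z X Y (𝟙_ C)).symm_apply_apply b
  conv_rhs => rw [← h]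
  rw [← unitors_equal, leftUnitor_naturality]
  simp

lemma whiskerRight_evaluation_injective {z z' : Z ⟶ Y}
    (h : z ▷ X ≫ ε_ X Y = z' ▷ X ≫ ε_ X Y) : z = z' := by
  have key (z : Z ⟶ Y) :
      z = (ρ_ Z).inv ≫ Z ◁ η_ X Y ≫ (α_ _ _ _).inv ≫ (z ▷ X ≫ ε_ X Y) ▷ Y ≫ (λ_ Y).hom := by
    rw [comp_whiskerRight_assoc, ← associator_inv_naturality_left_assoc, whisker_exchange_assoc,
      ExactPairing.coevaluation_evaluation_assoc]
    simp
  rw [key z, key z', h]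

lemma coevaluation_whiskerLeft_injective {z z' : Y ⟶ Z}
    (h : η_ X Y ≫ X ◁ z = η_ X Y ≫ X ◁ z') : z = z' := by
  have key (z : Y ⟶ Z) :
      z = (ρ_ Y).inv ≫ Y ◁ (η_ X Y ≫ X ◁ z) ≫ (α_ _ _ _).inv ≫ ε_ X Y ▷ Z ≫ (λ_ Z).hom := by
    rw [whiskerLeft_comp_assoc, associator_inv_naturality_right_assoc, whisker_exchange_assoc,
      ExactPairing.coevaluation_evaluation_assoc]
    simp
  rw [key z, key z', h]

/-- The transpose of a monomorphism is an epimorphism. -/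
lemma epi_of_mono_transpose [LeftRigidCategory C] {X' Y' : C} [ExactPairing X' Y'] (q : X' ⟶ X)
    [Mono q] (i : Y ⟶ Y') (h : i ▷ X' ≫ ε_ X' Y' = Y ◁ q ≫ ε_ X Y) : Epi i := by
  let : HasRightDual X := ⟨Y⟩
  let : HasRightDual X' := ⟨Y'⟩
  obtain rfl : i = rightAdjointMate q :=
    whiskerRight_evaluation_injective (h.trans (rightAdjointMate_comp_evaluation q).symm)
  refine ⟨fun {Z} g g' hg => coevaluation_whiskerLeft_injective (X := X') ?_⟩
  have key (g : Y' ⟶ Z) :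
      η_ X Y ≫ X ◁ (rightAdjointMate q ≫ g) = (η_ X' Y' ≫ X' ◁ g) ≫ q ▷ Z := by
    have : η_ X Y ≫ X ◁ rightAdjointMate q = η_ X' Y' ≫ q ▷ Y' :=
      coevaluation_comp_rightAdjointMate q
    rw [whiskerLeft_comp, reassoc_of% this, ← whisker_exchange, Category.assoc]
  rw [← cancel_mono (q ▷ Z), ← key, ← key, hg]

end Transpose

/-! ### Balanced pairings between right and left modules -/

/-- A pairing of a right module with a left module is balanced if `b (n a, m) = b (n, a m)`. -/
def Balanced (N : RightMod A) (M : Mod C A) (b : N.X ⊗ M.X ⟶ 𝟙_ C) : Prop :=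
  N.act ▷ M.X ≫ b = (α_ N.X A M.X).hom ≫ N.X ◁ act M ≫ b

namespace Balanced

variable {N : RightMod A} {L : Mod C A} [ExactPairing L.X N.X]

lemma act_comp_of_whiskerLeft (h : Balanced N L (ε_ L.X N.X)) {M : Mod C A}
    {z : M.X ⟶ L.X} (hb : Balanced N M (N.X ◁ z ≫ ε_ L.X N.X)) :
    act M ≫ z = A ◁ z ≫ act L := by
  apply whiskerLeft_evaluation_injective (Y := N.X)
  unfold Balanced at h hb
  rw [← Iso.inv_comp_eq, ← whisker_exchange_assoc, h] at hb
  rw [whiskerLeft_comp_assoc, ← hb]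
  simp

lemma act_comp_of_whiskerRight (h : Balanced N L (ε_ L.X N.X)) {M : RightMod A}
    {z : M.X ⟶ N.X} (hb : Balanced M L (z ▷ L.X ≫ ε_ L.X N.X)) :
    M.act ≫ z = z ▷ A ≫ N.act := by
  apply whiskerRight_evaluation_injective (X := L.X)
  unfold Balanced at h hb
  rw [whisker_exchange_assoc] at hb
  rw [comp_whiskerRight_assoc, hb, comp_whiskerRight_assoc, h]
  simp

lemma whiskerLeft {N : RightMod A} {M L : Mod C A} {b : N.X ⊗ L.X ⟶ 𝟙_ C} (h : Balanced N L b)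
    (f : M ⟶ L) : Balanced N M (N.X ◁ f.hom ≫ b) := by
  unfold Balanced at h ⊢
  rw [← whisker_exchange_assoc, h, ← whiskerLeft_comp_assoc, act_hom]
  simp

lemma whiskerRight {N M : RightMod A} {L : Mod C A} {b : N.X ⊗ L.X ⟶ 𝟙_ C} (h : Balanced N L b)
    (f : M ⟶ N) : Balanced M L (f.hom ▷ L.X ≫ b) := by
  unfold Balanced at h ⊢
  rw [← comp_whiskerRight_assoc, f.act_hom, comp_whiskerRight_assoc, h, whisker_exchange_assoc]
  simp

/-- Duals of isomorphic left modules are isomorphic right modules. -/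
lemma nonempty_iso (h : Balanced N L (ε_ L.X N.X)) {N' : RightMod A} {L' : Mod C A}
    [ExactPairing L'.X N'.X] (h' : Balanced N' L' (ε_ L'.X N'.X)) (e : L ≅ L') :
    Nonempty (N ≅ N') := by
  obtain ⟨z, hz⟩ := exists_whiskerRight_evaluation N'.X (N.X ◁ e.inv.hom ≫ ε_ L.X N.X)
  obtain ⟨z', hz'⟩ := exists_whiskerRight_evaluation N.X (N'.X ◁ e.hom.hom ≫ ε_ L'.X N'.X)
  have he : e.hom.hom ≫ e.inv.hom = 𝟙 _ := congrArg Mod.Hom.hom e.hom_inv_id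
  have he' : e.inv.hom ≫ e.hom.hom = 𝟙 _ := congrArg Mod.Hom.hom e.inv_hom_id
  refine ⟨⟨⟨z, h'.act_comp_of_whiskerRight ?_⟩, ⟨z', h.act_comp_of_whiskerRight ?_⟩, ?_, ?_⟩⟩
  · rw [hz]
    exact h.whiskerLeft e.inv
  · rw [hz']
    exact h'.whiskerLeft e.hom
  · ext
    apply whiskerRight_evaluation_injective (X := L.X)
    simp only [RightMod.comp_hom, comp_whiskerRight, Category.assoc, hz', RightMod.id_hom]
    rw [← whisker_exchange_assoc, hz, ← whiskerLeft_comp_assoc, he]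
    simp
  · ext
    apply whiskerRight_evaluation_injective (X := L'.X)
    simp only [RightMod.comp_hom, comp_whiskerRight, Category.assoc, hz, RightMod.id_hom]
    rw [← whisker_exchange_assoc, hz', ← whiskerLeft_comp_assoc, he']
    simp

end Balanced

/-- The left module structure on a dual of a right module. -/
lemma exists_dual_mod (N : RightMod A) (L : C) [ExactPairing L N.X] :
    ∃ (a : A ⊗ L ⟶ L) (h₁ : _) (h₂ : _), Balanced N (mkMod L a h₁ h₂) (ε_ L N.X) := by
  obtain ⟨a, ha⟩ := exists_whiskerLeft_evaluation L
    ((α_ N.X A L).inv ≫ N.act ▷ L ≫ ε_ L N.X)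
  refine ⟨a, ?_, ?_, (Iso.inv_comp_eq _).1 ha.symm⟩
  · apply whiskerLeft_evaluation_injective (Y := N.X)
    rw [whiskerLeft_comp_assoc, ha, associator_inv_naturality_middle_assoc,
      ← comp_whiskerRight_assoc, N.act_one]
    simp
  · apply whiskerLeft_evaluation_injective (Y := N.X)
    rw [whiskerLeft_comp_assoc, ha, associator_inv_naturality_middle_assoc,
      ← comp_whiskerRight_assoc, N.act_mul]
    simp only [whiskerLeft_comp, Category.assoc, ha]
    rw [associator_inv_naturality_right_assoc, whisker_exchange_assoc, ha]
    simp

/-- The morphism out of a free right module extending a morphism out of its generators. -/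
def RightMod.freeDesc {N : RightMod A} {Z : C} (h : Z ⟶ N.X) : (freeRight A).obj Z ⟶ N :=
  ⟨h ▷ A ≫ N.act, by
    change ((α_ Z A A).hom ≫ Z ◁ MonObj.mul (X := A)) ≫ h ▷ A ≫ N.act =
      (h ▷ A ≫ N.act) ▷ A ≫ N.act
    rw [Category.assoc, whisker_exchange_assoc, N.act_mul]
    simp⟩

lemma RightMod.unit_freeDesc {N : RightMod A} {Z : C} (h : Z ⟶ N.X) :
    (ρ_ Z).inv ≫ Z ◁ MonObj.one (X := A) ≫ (RightMod.freeDesc h).hom = h := by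
  change (ρ_ Z).inv ≫ Z ◁ MonObj.one (X := A) ≫ h ▷ A ≫ N.act = h
  rw [whisker_exchange_assoc, N.act_one]
  simp

instance RightMod.mono_hom {N N' : RightMod A} (i : N ⟶ N') [Mono i] : Mono i.hom where
  right_cancellation g h w := by
    have : RightMod.freeDesc g ≫ i = RightMod.freeDesc h ≫ i := by
      ext
      change (g ▷ A ≫ N.act) ≫ i.hom = (h ▷ A ≫ N.act) ≫ i.hom
      rw [Category.assoc, Category.assoc, i.act_hom, ← comp_whiskerRight_assoc, w,
        comp_whiskerRight_assoc]
    rw [← RightMod.unit_freeDesc g, ← RightMod.unit_freeDesc h, (cancel_mono i).1 this]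

/-! ### Frobenius forms -/

lemma balanced_regular (φ : A ⟶ 𝟙_ C) :
    Balanced (RightMod.regular A) (Mod.regular A) (MonObj.mul (X := A) ≫ φ) := by
  have h : MonObj.mul (X := A) ▷ A ≫ MonObj.mul ≫ φ =
      (α_ A A A).hom ≫ A ◁ MonObj.mul (X := A) ≫ MonObj.mul ≫ φ := by
    rw [MonObj.mul_assoc_assoc]
  exact h

lemma balanced_free [ExactPairing A A] {φ : A ⟶ 𝟙_ C} (hφ : ε_ A A = MonObj.mul (X := A) ≫ φ)
    (X Y : C) [ExactPairing X Y] :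
    Balanced ((freeRight A).obj Y) ((freeLeft A).obj X) (ε_ (A ⊗ X) (Y ⊗ A)) := by
  change ((α_ Y A A).hom ≫ Y ◁ MonObj.mul (X := A)) ▷ (A ⊗ X) ≫ ε_ (A ⊗ X) (Y ⊗ A) =
    (α_ (Y ⊗ A) A (A ⊗ X)).hom ≫ (Y ⊗ A) ◁ ((α_ A A X).inv ≫ MonObj.mul (X := A) ▷ X) ≫
      ε_ (A ⊗ X) (Y ⊗ A)
  rw [ExactPairing.tensor_evaluation, hφ]
  calc _ = 𝟙 _ ⊗≫ Y ◁ (MonObj.mul (X := A) ▷ A ≫ MonObj.mul (X := A) ≫ φ) ▷ X ⊗≫ ε_ X Y := by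
        monoidal
    _ = _ := by
        rw [MonObj.mul_assoc_assoc]
        monoidal

/-- A left essential algebra with a Frobenius form is right essential. -/
theorem freeRight_essSurj_of_frobenius [RigidCategory C] [ExactPairing A A] {φ : A ⟶ 𝟙_ C}
    (hφ : ε_ A A = MonObj.mul (X := A) ≫ φ) (h : (freeLeft A).EssSurj) :
    (freeRight A).EssSurj := by
  refine ⟨fun N => ?_⟩
  obtain ⟨a, h₁, h₂, hb⟩ := exists_dual_mod N (HasLeftDual.leftDual N.X)
  obtain ⟨X, ⟨e⟩⟩ := h.mem_essImage (mkMod _ a h₁ h₂)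
  let : ExactPairing ((freeLeft A).obj X).X
      ((freeRight A).obj (HasRightDual.rightDual X)).X :=
    inferInstanceAs (ExactPairing (A ⊗ X) (HasRightDual.rightDual X ⊗ A))
  exact ⟨_, (balanced_free hφ X (HasRightDual.rightDual X)).nonempty_iso hb e⟩

section Abelian

variable [Abelian C] [MonoidalPreadditive C]

/-- A left simplistic algebra with a Frobenius form is right simplistic. -/
theorem simple_rightRegular_of_frobenius [RigidCategory C] [ExactPairing A A] {φ : A ⟶ 𝟙_ C}
    (hφ : ε_ A A = MonObj.mul (X := A) ≫ φ) (hA : ¬ IsZero A) [Simple (Mod.regular A)] :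
    Simple (RightMod.regular A) := by
  refine ⟨fun {I} i _ => ⟨?_, fun hi => ?_⟩⟩
  · rintro _ rfl
    have h0 := congrArg RightMod.Hom.hom (IsIso.inv_hom_id (0 : I ⟶ RightMod.regular A))
    exact hA ((IsZero.iff_id_eq_zero A).2 (h0.symm.trans comp_zero))
  · let j : I.X ⟶ A := i.hom
    have : Mono j := RightMod.mono_hom i
    have hj : j ≠ 0 := fun h => hi (RightMod.hom_ext _ _ h)
    obtain ⟨a, h₁, h₂, hb⟩ := exists_dual_mod I (HasLeftDual.leftDual I.X)
    obtain ⟨q, hq⟩ := exists_whiskerLeft_evaluation (HasLeftDual.leftDual I.X) (j ▷ A ≫ ε_ A A)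
    have hbq : Balanced I (Mod.regular A) (I.X ◁ q ≫ ε_ (HasLeftDual.leftDual I.X) I.X) :=
      (congrArg (Balanced I (Mod.regular A)) (hq.trans (congrArg (j ▷ A ≫ ·) hφ))).mpr
        ((balanced_regular φ).whiskerRight i)
    let g : Mod.regular A ⟶ mkMod _ a h₁ h₂ := mkModHom q (hb.act_comp_of_whiskerLeft hbq)
    have hg : g ≠ 0 := by
      intro h0
      apply hj
      apply whiskerRight_evaluation_injective (X := A) (Y := A)
      have hq0 : q = 0 := congrArg Mod.Hom.hom h0
      rw [← hq, hq0]
      simp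
    have : Mono q := mono_hom_of_simple hg
    have : Epi j := epi_of_mono_transpose q j hq.symm
    have : IsIso i.hom := isIso_of_mono_of_epi j
    exact RightMod.isIso_of_isIso_hom i

/-- A linear form on a left module `A` is nondegenerate if its kernel contains no nonzero
submodule. -/
def Nondegenerate (φ : A ⟶ 𝟙_ C) : Prop :=
  ∀ (K : Mod C A) (i : K ⟶ Mod.regular A), Mono i → i.hom ≫ φ = 0 → i = 0

theorem exists_frobenius [RigidCategory C] {k : Type w} [Field k] [Linear k C]
    [∀ X Y : C, FiniteDimensional k (X ⟶ Y)] (hP : ∀ X : C, Projective X)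
    {B : C} [ExactPairing A B] [ExactPairing B A] {φ : A ⟶ 𝟙_ C} (hφ : Nondegenerate φ) :
    ∃ _ : ExactPairing A A, ε_ A A = MonObj.mul (X := A) ≫ φ := by
  let : ExactPairing B (RightMod.regular A).X := inferInstanceAs (ExactPairing B A)
  obtain ⟨a, h₁, h₂, hb⟩ := exists_dual_mod (RightMod.regular A) B
  obtain ⟨g, hg⟩ := exists_whiskerLeft_evaluation B (MonObj.mul (X := A) ≫ φ)
  obtain ⟨f, hf⟩ := exists_whiskerRight_evaluation B (MonObj.mul (X := A) ≫ φ)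
  let g' : Mod.regular A ⟶ mkMod B a h₁ h₂ := mkModHom g (hb.act_comp_of_whiskerLeft
    ((congrArg (Balanced (RightMod.regular A) (Mod.regular A)) hg).mpr (balanced_regular φ)))
  have : Mono g := by
    refine mono_hom_of_kernelModι_eq_zero (f := g') (hφ _ _ inferInstance ?_)
    have e : φ = (λ_ A).inv ≫ MonObj.one (X := A) ▷ A ≫ A ◁ g ≫ ε_ B A := by
      rw [hg, MonObj.one_mul_assoc, Iso.inv_hom_id_assoc]
    have h0 : kernel.ι g ≫ g = 0 := kernel.condition g
    suffices kernel.ι g ≫ φ = 0 from this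
    rw [e, leftUnitor_inv_naturality_assoc, whisker_exchange_assoc, ← whiskerLeft_comp_assoc, h0]
    simp
  have : Epi f := epi_of_mono_transpose (X := B) (Y := A) g f (hf.trans hg.symm)
  have hfs : Function.Surjective (Linear.rightComp k B f) := fun h =>
    have := hP B
    ⟨Projective.factorThru h f, Projective.factorThru_comp _ _⟩
  have hgi : Function.Injective (Linear.rightComp k B g) := fun h h' hh => (cancel_mono g).1 hh
  have hd := LinearMap.finrank_le_finrank_of_injective hgi
  have hd' := LinearMap.finrank_le_finrank_of_surjective hfs
  obtain ⟨s, hs⟩ := (LinearMap.injective_iff_surjective_of_finrank_eq_finrank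
    (le_antisymm hd hd')).1 hgi (𝟙 B)
  have : IsSplitEpi g := ⟨⟨s, hs⟩⟩
  have := isIso_of_mono_of_isSplitEpi g
  exact ⟨exactPairingCongrLeft (asIso g), hg⟩

/-! ### Existence of nondegenerate forms -/

lemma one_ne_zero (hA : ¬ IsZero A) : MonObj.one (X := A) ≠ 0 := by
  intro h
  apply hA
  rw [IsZero.iff_id_eq_zero, ← cancel_epi (λ_ A).hom, Category.comp_id, ← MonObj.one_mul, h]
  simp

lemma exists_nondegenerate_of_simple (hP : ∀ X : C, Projective X) (hA : ¬ IsZero A)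
    [Simple (Mod.regular A)] : ∃ φ : A ⟶ 𝟙_ C, Nondegenerate φ := by
  obtain ⟨φ, hφ⟩ := exists_comp_comp_self hP (MonObj.one (X := A))
  refine ⟨φ, fun K i _ h => ?_⟩
  by_contra hi
  have := isIso_of_mono_of_nonzero hi
  have := isIso_hom i
  have h0 : φ = 0 := (cancel_epi i.hom).1 (h.trans comp_zero.symm)
  apply one_ne_zero hA
  rw [← hφ, h0]
  simp

/-- Over an essential algebra, every submodule is the image of an idempotent. -/
lemma exists_idempotent [RigidCategory C] (hP : ∀ X : C, Projective X)
    (h : (freeLeft A).EssSurj) {K M : Mod C A} (i : K ⟶ M) : ∃ e : M ⟶ M, e ≫ e = e ∧ i ≫ e = i ∧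
      ∀ {Z : C} (g : M.X ⟶ Z), i.hom ≫ g = 0 → e.hom ≫ g = 0 := by
  obtain ⟨Q, p, hp, hip, hQ⟩ := exists_cokernel i
  obtain ⟨X, ⟨t⟩⟩ := h.mem_essImage Q
  have := hP X
  let t' : A ⊗ X ⟶ Q.X := t.hom.hom
  have ht : ((α_ A A X).inv ≫ MonObj.mul (X := A) ▷ X) ≫ t' = A ◁ t' ≫ act Q := act_hom t.hom
  let x : X ⟶ Q.X := (λ_ X).inv ≫ MonObj.one (X := A) ▷ X ≫ t'
  let y : X ⟶ M.X := Projective.factorThru x p.hom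
  have hy : y ≫ p.hom = x := Projective.factorThru_comp _ _
  let s : (freeLeft A).obj X ⟶ M := mkModHom (A ◁ y ≫ act M) (by
    change ((α_ A A X).inv ≫ MonObj.mul (X := A) ▷ X) ≫ A ◁ y ≫ act M =
      A ◁ (A ◁ y ≫ act M) ≫ act M
    rw [Category.assoc, ← whisker_exchange_assoc, mul_act]
    simp)
  have hsp : s ≫ p = t.hom := by
    ext
    suffices (A ◁ y ≫ act M) ≫ p.hom = t' from this
    rw [Category.assoc, act_hom, ← whiskerLeft_comp_assoc, hy]
    simp only [x, whiskerLeft_comp, Category.assoc, ← ht]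
    rw [associator_inv_naturality_middle_assoc, ← comp_whiskerRight_assoc, MonObj.mul_one]
    simp
  let σ : Q ⟶ M := t.inv ≫ s
  have hσ : σ.hom ≫ p.hom = 𝟙 Q.X := by
    have : σ ≫ p = 𝟙 Q := by rw [Category.assoc, hsp, t.inv_hom_id]
    exact congrArg Mod.Hom.hom this
  let e : M ⟶ M := mkModHom (𝟙 M.X - p.hom ≫ σ.hom) (by
    have hsub : A ◁ (𝟙 M.X - p.hom ≫ σ.hom) = A ◁ 𝟙 M.X - A ◁ (p.hom ≫ σ.hom) :=
      (tensorLeft A).map_sub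
    rw [hsub, Preadditive.comp_sub, Preadditive.sub_comp, ← Category.assoc (act M), act_hom p,
      Category.assoc, act_hom σ]
    simp)
  have he : e.hom = 𝟙 M.X - p.hom ≫ σ.hom := rfl
  refine ⟨e, ?_, ?_, fun {Z} g hg => ?_⟩
  · ext
    rw [Mod.comp_hom', he]
    simp [reassoc_of% hσ]
  · ext
    rw [Mod.comp_hom', he]
    simp [reassoc_of% hip]
  · obtain ⟨g', rfl⟩ := hQ g hg
    rw [he]
    simp [reassoc_of% hσ]

variable (A) in
/-- Right multiplication by an element `u : 𝟙_ C ⟶ A`. -/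
def rightMul (k : Type w) [Field k] [Linear k C] [MonoidalLinear k C] :
    (𝟙_ C ⟶ A) →ₗ[k] (A ⟶ A) where
  toFun u := (ρ_ A).inv ≫ A ◁ u ≫ MonObj.mul (X := A)
  map_add' u v := by simp
  map_smul' r u := by simp

lemma rightMul_one_comp (k : Type w) [Field k] [Linear k C] [MonoidalLinear k C] {e : A ⟶ A}
    (he : MonObj.mul (X := A) ≫ e = A ◁ e ≫ MonObj.mul (X := A)) :
    rightMul A k (MonObj.one (X := A) ≫ e) = e := by
  change (ρ_ A).inv ≫ A ◁ (MonObj.one (X := A) ≫ e) ≫ MonObj.mul (X := A) = e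
  rw [whiskerLeft_comp_assoc, ← he, MonObj.mul_one_assoc, Iso.inv_hom_id_assoc]

lemma exists_nondegenerate_of_essSurj [RigidCategory C] {k : Type w} [Field k]
    [CharZero k] [Linear k C] [MonoidalLinear k C] [∀ X Y : C, FiniteDimensional k (X ⟶ Y)]
    (hP : ∀ X : C, Projective X)
    (h : (freeLeft A).EssSurj) : ∃ φ : A ⟶ 𝟙_ C, Nondegenerate φ := by
  obtain ⟨φ, hφ⟩ := tracePairing_surjective (k := k) hP (𝟙_ C) A
    (LinearMap.trace k _ ∘ₗ (Linear.comp (𝟙_ C) A A).flip ∘ₗ rightMul A k)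
  refine ⟨φ, fun K i _ hi => ?_⟩
  obtain ⟨e, he, hie, hZ⟩ := exists_idempotent hP h i
  let ε : A ⟶ A := e.hom
  have hεε : ε ≫ ε = ε := congrArg Mod.Hom.hom he
  have hε := rightMul_one_comp k (e := ε) (act_hom e)
  have hεφ : ε ≫ φ = 0 := hZ φ hi
  have hφε := LinearMap.congr_fun hφ (MonObj.one (X := A) ≫ ε)
  rw [tracePairing_apply, Category.assoc, hεφ, comp_zero, map_zero, LinearMap.comp_apply,
    LinearMap.comp_apply, hε] at hφε
  have hi : IsIdempotentElem
      (show Module.End k (𝟙_ C ⟶ A) from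
        (Linear.comp (𝟙_ C) A A : _ →ₗ[k] _ →ₗ[k] _).flip ε) := by
    ext v
    simp [hεε]
  have h1 : MonObj.one (X := A) ≫ ε = 0 :=
    LinearMap.congr_fun (LinearMap.IsIdempotentElem.eq_zero_of_trace_eq_zero hi hφε.symm) _
  have h2 : ε = 0 := by rw [← hε, h1, map_zero]
  rw [← hie, eq_zero_of_hom_eq_zero e h2, comp_zero]

end Abelian

end DivAlg

namespace DivAlg

/-! ### The reversed monoidal category -/

section Reverse

open MonoidalOpposite

variable {C : Type u} [Category.{v} C]

/-- Morphisms of the reversed category are morphisms of the category. -/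
def unmopHomEquiv (X Y : Cᴹᵒᵖ) : (X ⟶ Y) ≃ (unmop X ⟶ unmop Y) where
  toFun f := f.unmop
  invFun f := f.mop

instance : (mopFunctor C).IsEquivalence :=
  inferInstanceAs (mopEquiv C).functor.IsEquivalence

instance : (unmopFunctor C).IsEquivalence :=
  inferInstanceAs (unmopEquiv C).functor.IsEquivalence

section Preadditive

variable [Preadditive C]

instance preadditiveMop : Preadditive Cᴹᵒᵖ where
  homGroup X Y := (unmopHomEquiv X Y).addCommGroup
  add_comp _ _ _ f f' g :=
    Quiver.Hom.unmop_inj (Preadditive.add_comp _ _ _ f.unmop f'.unmop g.unmop)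
  comp_add _ _ _ f g g' :=
    Quiver.Hom.unmop_inj (Preadditive.comp_add _ _ _ f.unmop g.unmop g'.unmop)

instance linearMop {k : Type w} [Field k] [Linear k C] : Linear k Cᴹᵒᵖ where
  homModule X Y := (unmopHomEquiv X Y).module k
  smul_comp _ _ _ r f g := Quiver.Hom.unmop_inj (Linear.smul_comp _ _ _ r f.unmop g.unmop)
  comp_smul _ _ _ f r g := Quiver.Hom.unmop_inj (Linear.comp_smul _ _ _ f.unmop r g.unmop)

lemma finiteDimensional_mop {k : Type w} [Field k] [Linear k C]
    [∀ X Y : C, FiniteDimensional k (X ⟶ Y)] (X Y : Cᴹᵒᵖ) : FiniteDimensional k (X ⟶ Y) :=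
  Module.Finite.equiv (M := unmop X ⟶ unmop Y)
    { (unmopHomEquiv X Y).symm with
      map_add' := fun _ _ => rfl
      map_smul' := fun _ _ => rfl }

end Preadditive

noncomputable instance abelianMop [Abelian C] : Abelian Cᴹᵒᵖ :=
  have : HasFiniteProducts Cᴹᵒᵖ :=
    ⟨fun _ => Adjunction.hasLimitsOfShape_of_equivalence (unmopFunctor C)⟩
  abelianOfEquivalence (unmopFunctor C)

lemma projective_mop (hP : ∀ X : C, Projective X) (X : Cᴹᵒᵖ) : Projective X :=
  ((unmopEquiv C).map_projective_iff X).1 (hP _)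

lemma isZero_mop_iff (X : C) : IsZero (mop X) ↔ IsZero X :=
  ⟨fun h => IsZero.of_full_of_faithful_of_isZero (mopFunctor C) X h,
    fun h => IsZero.of_full_of_faithful_of_isZero (unmopFunctor C) (mop X) h⟩

variable [MonoidalCategory C]

instance monoidalPreadditiveMop [Preadditive C] [MonoidalPreadditive C] :
    MonoidalPreadditive Cᴹᵒᵖ where
  whiskerLeft_zero {X _ _} :=
    Quiver.Hom.unmop_inj (MonoidalPreadditive.zero_whiskerRight (X := unmop X))
  zero_whiskerRight {X _ _} :=
    Quiver.Hom.unmop_inj (MonoidalPreadditive.whiskerLeft_zero (X := unmop X))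
  whiskerLeft_add f g :=
    Quiver.Hom.unmop_inj (MonoidalPreadditive.add_whiskerRight f.unmop g.unmop)
  add_whiskerRight f g :=
    Quiver.Hom.unmop_inj (MonoidalPreadditive.whiskerLeft_add f.unmop g.unmop)

instance monoidalLinearMop {k : Type w} [Field k] [Preadditive C] [MonoidalPreadditive C]
    [Linear k C] [MonoidalLinear k C] : MonoidalLinear k Cᴹᵒᵖ where
  whiskerLeft_smul X _ _ r f :=
    Quiver.Hom.unmop_inj (MonoidalLinear.smul_whiskerRight r f.unmop (unmop X))
  smul_whiskerRight r _ _ f X :=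
    Quiver.Hom.unmop_inj (MonoidalLinear.whiskerLeft_smul (unmop X) r f.unmop)

/-- An exact pairing becomes an exact pairing in the opposite order in the reversed category. -/
@[reducible]
def exactPairingMop (X Y : C) [ExactPairing X Y] : ExactPairing (mop Y) (mop X) where
  coevaluation' := (η_ X Y).mop
  evaluation' := (ε_ X Y).mop
  coevaluation_evaluation' := Quiver.Hom.unmop_inj (ExactPairing.evaluation_coevaluation X Y)
  evaluation_coevaluation' := Quiver.Hom.unmop_inj (ExactPairing.coevaluation_evaluation X Y)

instance rigidMop [RigidCategory C] : RigidCategory Cᴹᵒᵖ where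
  rightDual X :=
    { rightDual := mop (HasLeftDual.leftDual (unmop X))
      exact := exactPairingMop (HasLeftDual.leftDual (unmop X)) (unmop X) }
  leftDual X :=
    { leftDual := mop (HasRightDual.rightDual (unmop X))
      exact := exactPairingMop (unmop X) (HasRightDual.rightDual (unmop X)) }

instance simple_unit_mop [Preadditive C] [Simple (𝟙_ C)] : Simple (𝟙_ Cᴹᵒᵖ) :=
  have : Simple ((unmopFunctor C).obj (𝟙_ Cᴹᵒᵖ)) := inferInstanceAs (Simple (𝟙_ C))
  (simple_obj_iff (unmopFunctor C) (𝟙_ Cᴹᵒᵖ)).1 this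

variable (A : C) [MonObj A]

/-- Left modules in the reversed category are right modules. -/
def leftModMop : Mod Cᴹᵒᵖ (mop A) ⥤ RightMod A where
  obj M :=
    { X := unmop M.X
      act := (act M).unmop
      act_one := congrArg Quiver.Hom.unmop (one_act M)
      act_mul := congrArg Quiver.Hom.unmop (mul_act M) }
  map f :=
    { hom := f.hom.unmop
      act_hom := congrArg Quiver.Hom.unmop (act_hom f) }

instance : (leftModMop A).Faithful where
  map_injective h := Mod.hom_ext _ _ (Quiver.Hom.unmop_inj (congrArg RightMod.Hom.hom h))

instance : (leftModMop A).Full where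
  map_surjective f := ⟨mkModHom f.hom.mop (Quiver.Hom.unmop_inj f.act_hom), rfl⟩

instance : (leftModMop A).EssSurj where
  mem_essImage N := ⟨mkMod (mop N.X) N.act.mop (Quiver.Hom.unmop_inj N.act_one)
    (Quiver.Hom.unmop_inj N.act_mul), ⟨Iso.refl _⟩⟩

instance : (leftModMop A).IsEquivalence where

/-- Right modules in the reversed category are left modules. -/
def rightModMop : RightMod (mop A) ⥤ Mod C A where
  obj N := mkMod (unmop N.X) N.act.unmop (congrArg Quiver.Hom.unmop N.act_one)
    (congrArg Quiver.Hom.unmop N.act_mul)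
  map f := mkModHom f.hom.unmop (congrArg Quiver.Hom.unmop f.act_hom)

instance : (rightModMop A).Faithful where
  map_injective h := RightMod.hom_ext _ _ (Quiver.Hom.unmop_inj (congrArg Mod.Hom.hom h))

instance : (rightModMop A).Full where
  map_surjective f := ⟨⟨f.hom.mop, Quiver.Hom.unmop_inj (act_hom f)⟩, rfl⟩

instance : (rightModMop A).EssSurj where
  mem_essImage M :=
    ⟨{ X := mop M.X
       act := (act M).mop
       act_one := Quiver.Hom.unmop_inj (one_act M)
       act_mul := Quiver.Hom.unmop_inj (mul_act M) }, ⟨Iso.refl _⟩⟩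

instance : (rightModMop A).IsEquivalence where

lemma freeLeft_mop_essSurj_iff :
    (freeLeft (mop A)).EssSurj ↔ (freeRight A).EssSurj := by
  constructor
  · intro h
    have : (freeLeft (mop A) ⋙ leftModMop A).EssSurj := inferInstance
    have : (unmopFunctor C ⋙ freeRight A).EssSurj := this
    exact ⟨fun N => by
      obtain ⟨X, hX⟩ := this.mem_essImage N
      exact ⟨unmop X, hX⟩⟩
  · intro h
    have : (unmopFunctor C ⋙ freeRight A).EssSurj := inferInstance
    have : (freeLeft (mop A) ⋙ leftModMop A).EssSurj := this
    exact Functor.essSurj_of_comp_fully_faithful _ (leftModMop A)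

lemma freeRight_mop_essSurj_iff :
    (freeRight (mop A)).EssSurj ↔ (freeLeft A).EssSurj := by
  constructor
  · intro h
    have : (freeRight (mop A) ⋙ rightModMop A).EssSurj := inferInstance
    have : (unmopFunctor C ⋙ freeLeft A).EssSurj := this
    exact ⟨fun N => by
      obtain ⟨X, hX⟩ := this.mem_essImage N
      exact ⟨unmop X, hX⟩⟩
  · intro h
    have : (unmopFunctor C ⋙ freeLeft A).EssSurj := inferInstance
    have : (freeRight (mop A) ⋙ rightModMop A).EssSurj := this
    exact Functor.essSurj_of_comp_fully_faithful _ (rightModMop A)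

lemma isLeftEssential_mop_iff : IsLeftEssential (mop A) ↔ IsRightEssential A :=
  and_congr (not_congr (isZero_mop_iff A)) (freeLeft_mop_essSurj_iff A)

lemma isRightEssential_mop_iff : IsRightEssential (mop A) ↔ IsLeftEssential A :=
  and_congr (not_congr (isZero_mop_iff A)) (freeRight_mop_essSurj_iff A)

variable [Preadditive C] [MonoidalPreadditive C]

lemma isLeftSimplistic_mop_iff : IsLeftSimplistic (mop A) ↔ IsRightSimplistic A :=
  and_congr (not_congr (isZero_mop_iff A))
    (simple_obj_iff (leftModMop A) (Mod.regular (mop A))).symm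

lemma isRightSimplistic_mop_iff : IsRightSimplistic (mop A) ↔ IsLeftSimplistic A :=
  and_congr (not_congr (isZero_mop_iff A))
    (simple_obj_iff (rightModMop A) (RightMod.regular (mop A))).symm

lemma exists_simple_mop (h : ∃ S : RightMod A, Simple S) : ∃ S : Mod Cᴹᵒᵖ (mop A), Simple S := by
  obtain ⟨S, hS⟩ := h
  have := Simple.of_iso ((leftModMop A).objObjPreimageIso S)
  exact ⟨_, (simple_obj_iff (leftModMop A) _).1 this⟩

end Reverse

/-! ### The main theorem -/

variable {C : Type u} [Category.{v} C] [Abelian C] [MonoidalCategory C] [MonoidalPreadditive C]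
  {A : C} [MonObj A] [RigidCategory C]

theorem IsLeftEssential.isLeftSimplistic [Simple (𝟙_ C)] (h : IsLeftEssential A)
    (hS : ∃ S : Mod C A, Simple S) : IsLeftSimplistic A := by
  obtain ⟨S, _⟩ := hS
  exact ⟨h.1, simple_regular_of_simple h.2 h.1 S⟩

theorem IsRightEssential.isRightSimplistic [Simple (𝟙_ C)] (h : IsRightEssential A)
    (hS : ∃ S : RightMod A, Simple S) : IsRightSimplistic A :=
  (isLeftSimplistic_mop_iff A).1
    (((isLeftEssential_mop_iff A).2 h).isLeftSimplistic (exists_simple_mop A hS))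

theorem IsLeftEssential.isRightEssential
    (k : Type w) [Field k] [CharZero k] [Linear k C] [MonoidalLinear k C]
    [∀ X Y : C, FiniteDimensional k (X ⟶ Y)] (hP : ∀ X : C, Projective X)
    {B : C} [ExactPairing A B] [ExactPairing B A]
    (h : IsLeftEssential A) : IsRightEssential A := by
  obtain ⟨φ, hφ⟩ := exists_nondegenerate_of_essSurj (k := k) hP h.2
  obtain ⟨_, hE⟩ := exists_frobenius (k := k) (B := B) hP hφ
  exact ⟨h.1, freeRight_essSurj_of_frobenius hE h.2⟩

theorem IsLeftSimplistic.isRightSimplistic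
    (k : Type w) [Field k] [Linear k C]
    [∀ X Y : C, FiniteDimensional k (X ⟶ Y)] (hP : ∀ X : C, Projective X)
    {B : C} [ExactPairing A B] [ExactPairing B A]
    (h : IsLeftSimplistic A) : IsRightSimplistic A := by
  have := h.2
  obtain ⟨φ, hφ⟩ := exists_nondegenerate_of_simple hP h.1
  obtain ⟨_, hE⟩ := exists_frobenius (k := k) (B := B) hP hφ
  exact ⟨h.1, simple_rightRegular_of_frobenius hE h.1⟩

theorem isLeftEssential_iff_isRightEssential
    (k : Type w) [Field k] [CharZero k] [Linear k C] [MonoidalLinear k C]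
    [∀ X Y : C, FiniteDimensional k (X ⟶ Y)] (hP : ∀ X : C, Projective X)
    {B : C} [ExactPairing A B] [ExactPairing B A] :
    IsLeftEssential A ↔ IsRightEssential A := by
  refine ⟨fun h => h.isRightEssential (k := k) hP (B := B), fun h => ?_⟩
  have := finiteDimensional_mop (k := k) (C := C)
  let := exactPairingMop A B
  let := exactPairingMop B A
  exact (isRightEssential_mop_iff A).1 (((isLeftEssential_mop_iff A).2 h).isRightEssential (k := k)
    (projective_mop hP) (B := .mop B))

theorem isLeftSimplistic_iff_isRightSimplistic
    (k : Type w) [Field k] [Linear k C]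
    [∀ X Y : C, FiniteDimensional k (X ⟶ Y)] (hP : ∀ X : C, Projective X)
    {B : C} [ExactPairing A B] [ExactPairing B A] :
    IsLeftSimplistic A ↔ IsRightSimplistic A := by
  refine ⟨fun h => h.isRightSimplistic (k := k) hP (B := B), fun h => ?_⟩
  have := finiteDimensional_mop (k := k) (C := C)
  let := exactPairingMop A B
  let := exactPairingMop B A
  exact (isRightSimplistic_mop_iff A).1 (((isLeftSimplistic_mop_iff A).2 h).isRightSimplistic
    (k := k) (projective_mop hP) (B := .mop B))

/-- In a pivotal category the dual of an object is also its dual on the other side. -/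
@[reducible]
def PivotalStructure.dualPairing (p : PivotalStructure C) (X : C) : ExactPairing (dual X) X :=
  letI := DivAlg.dualPairing (dual X)
  exactPairingCongrRight (p.iso X)

end DivAlg

theorem theorem1p3 {C : Type u} [Category.{v} C] [Abelian C] [MonoidalCategory C]
    [MonoidalPreadditive C] (A : C) [MonObj A] (hA : ¬ IsZero A) :
    -- (i) monadic is equivalent to essential
    ((DivAlg.IsLeftMonadic A ↔ DivAlg.IsLeftEssential A) ∧
      (DivAlg.IsRightMonadic A ↔ DivAlg.IsRightEssential A)) ∧
    -- (ii) essential implies simplistic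
    (∀ [RigidCategory C] [Simple (𝟙_ C)],
      ((∃ S : Mod C A, Simple S) → DivAlg.IsLeftEssential A → DivAlg.IsLeftSimplistic A) ∧
      ((∃ S : DivAlg.RightMod A, Simple S) →
        DivAlg.IsRightEssential A → DivAlg.IsRightSimplistic A)) ∧
    -- (iii) left is equivalent to right
    (∀ (k : Type w) [Field k] [IsAlgClosed k] [CharZero k] [Linear k C] [MonoidalLinear k C]
      [RigidCategory C], DivAlg.IsMultifusion k C → Nonempty (DivAlg.PivotalStructure C) →
      ((DivAlg.IsLeftMonadic A ↔ DivAlg.IsRightMonadic A) ∧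
        (DivAlg.IsLeftEssential A ↔ DivAlg.IsRightEssential A) ∧
        (DivAlg.IsLeftSimplistic A ↔ DivAlg.IsRightSimplistic A))) := by
  refine ⟨⟨DivAlg.isLeftMonadic_iff_isLeftEssential, DivAlg.isRightMonadic_iff_isRightEssential⟩,
    ⟨fun hS h => h.isLeftSimplistic hS, fun hS h => h.isRightSimplistic hS⟩, ?_⟩
  intro k _ _ _ _ _ _ hC ⟨p⟩
  have hP := hC.semisimple.projective
  have := hC.finite.finite_hom
  let := DivAlg.dualPairing A
  let := p.dualPairing A
  have he := DivAlg.isLeftEssential_iff_isRightEssential (A := A) k hP (B := DivAlg.dual A)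
  refine ⟨?_, he, DivAlg.isLeftSimplistic_iff_isRightSimplistic k hP (B := DivAlg.dual A)⟩
  rw [DivAlg.isLeftMonadic_iff_isLeftEssential, DivAlg.isRightMonadic_iff_isRightEssential, he]
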